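/- Let $d,n\ge 0$ be integers and let $A$ be a positive semidefinite (complex Hermitian) $d\times d$ matrix. For $\mathcal S\subseteq\{1,\dots,d\}$ let $A[\mathcal S]$ be the principal submatrix of $A$ with rows and columns indexed by $\mathcal S$, with $\det A[\emptyset]=1$. For $\alpha=(\alpha_1,\dots,\alpha_n)\in\mathbb N^n$ (where $0\in\mathbb N$) with $|\alpha|:=\alpha_1+\cdots+\alpha_n=d$ put $$S_\alpha(A)=\sum_{(\mathcal S_1,\dots,\mathcal S_n)}\ \prod_{i=1}^n\det\left(A[\mathcal S_i]\right),\qquad \overline S_\alpha(A)=\binom{d}{\alpha}^{-1}S_\alpha(A),\qquad \binom d\alpha=\frac{d!}{\alpha_1!\cdots\alpha_n!},$$ where the sum runs over all ordered partitions of $\{1,\dots,d\}$ into pairwise disjoint (possibly empty) sets $\mathcal S_1,\dots,\mathcal S_n$ with $|\mathcal S_i|=\alpha_i$ for $1\le i\le n$. For $x,y\in\mathbb R^n$ write $x\prec y$ if $\sum_{i=1}^k x_{[i]}\le\sum_{i=1}^k y_{[i]}$ for $1\le k\le n$, with equality for $k=n$, where $w_{[1]}\ge\cdots\ge w_{[n]}$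 is the decreasing rearrangement of $w\in\mathbb R^n$. Let $e_1,\dots,e_n$ be the standard basis of $\mathbb R^n$. Then all the numbers $\overline S_\alpha(A)$ with $|\alpha|=d$ are real, and: (a) $\overline S_\alpha(A)\le\overline S_\beta(A)$ for all $\alpha,\beta\in\mathbb N^n$ with $|\alpha|=|\beta|=d$ and $\beta\prec\alpha$; (b) for all $\alpha\in\mathbb N^n$ with $|\alpha|=d$, all indices $i,j$ with $\alpha_i\ge\alpha_j>0$ and all integers $k$ with $-\alpha_i+1\le k\le\alpha_j-1$, $$\overline S_{\alpha+k(e_i-e_j)}(A)^2\ \ge\ \overline S_{\alpha+(k-1)(e_i-e_j)}(A)\;\overline S_{\alpha+(k+1)(e_i-e_j)}(A).$$ -/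

import Mathlib

open scoped ComplexOrder

namespace Fischer

/-- The principal submatrix of `A` whose rows and columns are indexed by `S`. The determinant of
the one indexed by the empty set is `1`. -/
def principalSubmatrix {d : ℕ} (A : Matrix (Fin d) (Fin d) ℂ) (S : Finset (Fin d)) :
    Matrix S S ℂ :=
  A.submatrix Subtype.val Subtype.val

/-- The ordered partitions `(S₁, …, Sₙ)` of the index set of order `d` into `n` pairwise disjoint
(possibly empty) parts with `|Sᵢ| = αᵢ`. -/
def orderedPartitions (d : ℕ) {n : ℕ} (α : Fin n → ℕ) : Finset (Fin n → Finset (Fin d)) :=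
  {S | (∀ i j, i ≠ j → Disjoint (S i) (S j)) ∧ Finset.univ.biUnion S = Finset.univ ∧
    ∀ i, (S i).card = α i}

/-- The symmetrized Fischer product `S_α(A)`. -/
noncomputable def symmetrizedProduct {d n : ℕ} (α : Fin n → ℕ) (A : Matrix (Fin d) (Fin d) ℂ) :
    ℂ :=
  ∑ S ∈ orderedPartitions d α, ∏ i, (principalSubmatrix A (S i)).det

/-- The average symmetrized Fischer product: `S_α(A)` divided by the multinomial coefficient
`(α₁ + ⋯ + αₙ)! / (α₁! ⋯ αₙ!)`. It is used for `α₁ + ⋯ + αₙ = d`. -/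
noncomputable def averageProduct {d n : ℕ} (α : Fin n → ℕ) (A : Matrix (Fin d) (Fin d) ℂ) : ℂ :=
  (Nat.multinomial Finset.univ α : ℂ)⁻¹ * symmetrizedProduct α A

/-- The decreasing rearrangement `w_[1] ≥ ⋯ ≥ w_[n]` of a real tuple. -/
noncomputable def decreasingRearrangement {n : ℕ} (w : Fin n → ℝ) : Fin n → ℝ :=
  fun i => w (Tuple.sort w i.rev)

/-- `Majorized x y` is the majorization preorder `x ≺ y`, that is, `y` majorizes `x`: each partial
sum of the `k` largest entries of `x` is at most that of `y`, with equality for `k = n`. -/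
def Majorized {n : ℕ} (x y : Fin n → ℝ) : Prop :=
  (∀ k : ℕ, 1 ≤ k → k ≤ n →
    ∑ i ∈ Finset.univ.filter (fun i : Fin n => (i : ℕ) < k), decreasingRearrangement x i ≤
      ∑ i ∈ Finset.univ.filter (fun i : Fin n => (i : ℕ) < k), decreasingRearrangement y i) ∧
  ∑ i, decreasingRearrangement x i = ∑ i, decreasingRearrangement y i

/-- The multi-index `α + k (eᵢ - eⱼ)`. It is used only for `-αᵢ ≤ k ≤ αⱼ`, where all the entries
are nonnegative, so that `Int.toNat` changes nothing. -/
def shift {n : ℕ} (α : Fin n → ℕ) (i j : Fin n) (k : ℤ) : Fin n → ℕ :=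
  fun l => ((α l : ℤ) + k * ((Pi.single i 1 : Fin n → ℤ) l - (Pi.single j 1 : Fin n → ℤ) l)).toNat

end Fischer

/-! For positive semidefinite `A`, the polynomial `F(z, x) = ∏ᵢ det (diag z + xᵢ A)` is homogeneous
of degree `n d` and has no zero with all variables in the open upper half-plane. Expanding the
determinants, the coefficient of `(∏ₐ zₐ)^(n-1) ∏ᵢ xᵢ^αᵢ` is `S_α(A)`. Multiplied by the factorials
of its exponents, it is the average product times `(n-1)!^d d!`, a constant independent of `α`. So
the averages are, up to one common factor, iterated partial derivatives of `F` at `0`.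

By Gauss–Lucas, differentiation preserves limits of stable polynomials. Differentiating down to
degree 2 leaves a quadratic form satisfying the reversed Cauchy–Schwarz inequality `q_ii q_jj ≤
q_ij²`. This is (b); see `IsStableLimit.factorialCoeff_mul_le` and `averageProduct_eq`.

For (a), take `A` positive definite first. With `αᵢ + αⱼ` and the other entries fixed, the averages
form a positive, symmetric, log-concave sequence, so moving a unit from a larger entry towards a
smaller one does not decrease them. Majorization decomposes into such moves (`le_of_partialSum_le`),
and the semidefinite case follows by continuity from `A + ε I`. -/

namespace Fischer

open MvPolynomial Filter Topology

/-! ### Stable homogeneous polynomials and their derivatives -/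

variable {σ : Type*}

/-- A real polynomial is stable if it has no zero all of whose coordinates lie in the open upper
half-plane. -/
def IsStable (F : MvPolynomial σ ℝ) : Prop :=
  ∀ w : σ → ℂ, (∀ i, 0 < (w i).im) → aeval w F ≠ 0

/-- The restriction of a polynomial to the line through `w` in direction `v`. -/
noncomputable def lineRestriction (w v : σ → ℂ) : MvPolynomial σ ℝ →ₐ[ℝ] Polynomial ℂ :=
  aeval fun i => Polynomial.C (w i) + Polynomial.X * Polynomial.C (v i)

theorem eval_lineRestriction (w v : σ → ℂ) (F : MvPolynomial σ ℝ) (t : ℂ) :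
    (lineRestriction w v F).eval t = aeval (fun i => w i + t * v i) F := by
  induction F using MvPolynomial.induction_on with
  | C a => simp [lineRestriction, Polynomial.algebraMap_apply]
  | add p q hp hq => simp [hp, hq]
  | mul_X p i h => rw [map_mul, Polynomial.eval_mul, h]; simp [lineRestriction, mul_comm t]

theorem aeval_mul_of_isHomogeneous {F : MvPolynomial σ ℝ} {N : ℕ} (hF : F.IsHomogeneous N)
    (t : ℂ) (w : σ → ℂ) : aeval (fun i => t * w i) F = t ^ N * aeval w F := by
  rw [aeval_def, aeval_def, eval₂_eq, eval₂_eq, Finset.mul_sum]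
  refine Finset.sum_congr rfl fun s hs => ?_
  have h := hF.degree_eq_sum_deg_support hs
  simp only [mul_pow, Finset.prod_mul_distrib, Finset.prod_pow_eq_pow_sum]
  rw [h]
  ring

/-- Homogeneity lets the positive real point be rotated by `Complex.I` into the upper half-plane. -/
theorem IsStable.aeval_ofReal_ne_zero {F : MvPolynomial σ ℝ} {N : ℕ} (hF : F.IsHomogeneous N)
    (hs : IsStable F) {v : σ → ℝ} (hv : ∀ i, 0 < v i) :
    aeval (fun i => (v i : ℂ)) F ≠ 0 := by
  intro h
  refine hs (fun i => Complex.I * v i) (fun i => by simpa using hv i) ?_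
  rw [aeval_mul_of_isHomogeneous hF, h, mul_zero]

/-- If the restriction were a constant `c`, then `F(v + s w) = s^(N+1) F(w + v/s) = c s^(N+1)` for
`s ≠ 0`, hence as polynomials in `s`, and `s = 0` gives `F(v) = 0`. -/
theorem degree_lineRestriction_pos {F : MvPolynomial σ ℝ} {N : ℕ} (hF : F.IsHomogeneous (N + 1))
    (w v : σ → ℂ) (hv : aeval v F ≠ 0) : 0 < (lineRestriction w v F).degree := by
  by_contra hdeg
  have hconst := Polynomial.eq_C_of_degree_le_zero (not_lt.mp hdeg)
  set c := (lineRestriction w v F).coeff 0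
  have hc (t : ℂ) : aeval (fun i => w i + t * v i) F = c := by
    rw [← eval_lineRestriction, hconst, Polynomial.eval_C]
  have key : lineRestriction v w F = Polynomial.C c * Polynomial.X ^ (N + 1) := by
    refine Polynomial.eq_of_infinite_eval_eq _ _ ((Set.infinite_univ.sdiff
      (Set.finite_singleton (0 : ℂ))).mono fun s hs => ?_)
    have hs0 : s ≠ 0 := by simpa using hs
    have : (fun i => v i + s * w i) = fun i => s * (w i + s⁻¹ * v i) := by
      funext i; field_simp; ring
    rw [Set.mem_ofPred_eq, eval_lineRestriction, this, aeval_mul_of_isHomogeneous hF, hc,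
      Polynomial.eval_mul, Polynomial.eval_C, Polynomial.eval_pow, Polynomial.eval_X, mul_comm]
  apply hv
  have h0 := congrArg (Polynomial.eval 0) key
  rw [eval_lineRestriction] at h0
  simpa using h0

/-- `F` is a coefficientwise limit of stable homogeneous polynomials of degree `N`. -/
def IsStableLimit (N : ℕ) (F : MvPolynomial σ ℝ) : Prop :=
  ∃ G : ℕ → MvPolynomial σ ℝ, (∀ m, (G m).IsHomogeneous N ∧ IsStable (G m)) ∧
    ∀ s, Tendsto (fun m => coeff s (G m)) atTop (𝓝 (coeff s F))

theorem IsStable.isStableLimit {N : ℕ} {F : MvPolynomial σ ℝ} (hF : F.IsHomogeneous N)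
    (hs : IsStable F) : IsStableLimit N F :=
  ⟨fun _ => F, fun _ => ⟨hF, hs⟩, fun _ => tendsto_const_nhds⟩

/-- The direction `eᵢ + (1, …, 1) / (m + 1)`, which lies in the open positive orthant. -/
noncomputable def perturbedBasis [DecidableEq σ] (i : σ) (m : ℕ) : σ → ℝ :=
  fun k => (Pi.single i 1 : σ → ℝ) k + 1 / ((m : ℝ) + 1)

theorem perturbedBasis_pos [DecidableEq σ] (i : σ) (m : ℕ) (k : σ) : 0 < perturbedBasis i m k := by
  have : 0 ≤ (Pi.single i 1 : σ → ℝ) k := by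
    rw [Pi.single_apply]; split_ifs <;> simp
  unfold perturbedBasis
  positivity

theorem tendsto_perturbedBasis [DecidableEq σ] (i k : σ) :
    Tendsto (fun m => perturbedBasis i m k) atTop (𝓝 ((Pi.single i 1 : σ → ℝ) k)) := by
  simpa [perturbedBasis] using
    (tendsto_one_div_add_atTop_nhds_zero_nat (𝕜 := ℝ)).const_add ((Pi.single i 1 : σ → ℝ) k)

variable [Fintype σ]

/-- The derivative of a polynomial in direction `v`. -/
noncomputable def dirDeriv (v : σ → ℝ) (F : MvPolynomial σ ℝ) : MvPolynomial σ ℝ :=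
  ∑ i, C (v i) * pderiv i F

theorem derivative_lineRestriction (w : σ → ℂ) (v : σ → ℝ) (F : MvPolynomial σ ℝ) :
    (lineRestriction w (fun i => (v i : ℂ)) F).derivative =
      lineRestriction w (fun i => (v i : ℂ)) (dirDeriv v F) := by
  classical
  have hC (a : ℝ) : lineRestriction w (fun i => (v i : ℂ)) (C a) = Polynomial.C (a : ℂ) := by
    simp [lineRestriction, Polynomial.algebraMap_apply]
  induction F using MvPolynomial.induction_on with
  | C a => simp [hC, dirDeriv]
  | add p q hp hq => simp [hp, hq, dirDeriv, mul_add, Finset.sum_add_distrib]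
  | mul_X p i h =>
    have h1 : dirDeriv v (p * X i) = dirDeriv v p * X i + p * C (v i) := by
      simp only [dirDeriv, pderiv_mul, pderiv_X, mul_add, Finset.sum_add_distrib, Finset.sum_mul,
        mul_assoc]
      congr 1
      rw [Finset.sum_eq_single i]
      · simp [mul_comm]
      · intro j _ hj; simp [hj.symm]
      · simp
    have hX : (lineRestriction w (fun i => (v i : ℂ)) (X i)).derivative =
        Polynomial.C (v i : ℂ) := by
      simp [lineRestriction]
    rw [h1, map_mul, Polynomial.derivative_mul, h, hX, map_add, map_mul, map_mul, hC]

theorem isHomogeneous_dirDeriv {F : MvPolynomial σ ℝ} {N : ℕ} (hF : F.IsHomogeneous (N + 1))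
    (v : σ → ℝ) : (dirDeriv v F).IsHomogeneous N :=
  IsHomogeneous.sum _ _ _ fun _ _ => hF.pderiv.C_mul _

/-- Gauss–Lucas on the line `w + t v`: all roots in `t` lie in the open lower half-plane, hence so
do those of the derivative, and `t = 0` is not among them. -/
theorem IsStable.dirDeriv {F : MvPolynomial σ ℝ} {N : ℕ} (hF : F.IsHomogeneous (N + 1))
    (hs : IsStable F) {v : σ → ℝ} (hv : ∀ i, 0 < v i) : IsStable (dirDeriv v F) := by
  intro w hw h0
  set P := lineRestriction w (fun i => (v i : ℂ)) F with hP
  have hdeg : 0 < P.degree := degree_lineRestriction_pos hF _ _ (hs.aeval_ofReal_ne_zero hF hv)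
  have hroots : P.rootSet ℂ ⊆ {z : ℂ | z.im < 0} := by
    intro t ht
    rw [Polynomial.mem_rootSet, Polynomial.coe_aeval_eq_eval] at ht
    by_contra hneg
    have hneg : 0 ≤ t.im := not_lt.mp hneg
    refine hs (fun i => w i + t * v i) (fun i => ?_) (by rw [← eval_lineRestriction]; exact ht.2)
    simpa using add_pos_of_pos_of_nonneg (hw i) (mul_nonneg hneg (hv i).le)
  have hconv : Convex ℝ {z : ℂ | z.im < 0} := convex_halfSpace_im_lt 0
  have hmem : (0 : ℂ) ∈ P.derivative.rootSet ℂ := by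
    rw [Polynomial.mem_rootSet, Polynomial.coe_aeval_eq_eval]
    refine ⟨fun h => hdeg.not_ge ?_, ?_⟩
    · rw [← Polynomial.natDegree_eq_zero_iff_degree_le_zero]
      exact Polynomial.derivative_eq_zero.mp h
    · rw [hP, derivative_lineRestriction, eval_lineRestriction]
      simpa using h0
  have := convexHull_min hroots hconv
    (Polynomial.rootSet_derivative_subset_convexHull_rootSet hdeg hmem)
  simp at this

/-- Coordinate directions lie on the boundary of the positive orthant, where the derivative may
vanish identically. They are approached from inside, which is why the class is closed under limits.
-/
theorem IsStableLimit.pderiv {N : ℕ} {F : MvPolynomial σ ℝ} (hF : IsStableLimit (N + 1) F)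
    (i : σ) : IsStableLimit N (pderiv i F) := by
  classical
  obtain ⟨G, hG, hlim⟩ := hF
  refine ⟨fun m => Fischer.dirDeriv (perturbedBasis i m) (G m), fun m =>
    ⟨isHomogeneous_dirDeriv (hG m).1 _, (hG m).2.dirDeriv (hG m).1 (perturbedBasis_pos i m)⟩,
    fun s => ?_⟩
  have h : Tendsto (fun m => ∑ k, perturbedBasis i m k *
      (coeff (s + Finsupp.single k 1) (G m) * ((s k : ℝ) + 1))) atTop
      (𝓝 (∑ k, (Pi.single i 1 : σ → ℝ) k *
        (coeff (s + Finsupp.single k 1) F * ((s k : ℝ) + 1)))) :=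
    tendsto_finsetSum _ fun k _ => (tendsto_perturbedBasis i k).mul ((hlim _).mul_const _)
  simpa [Fischer.dirDeriv, coeff_sum, coeff_C_mul, coeff_pderiv, Pi.single_apply] using h

/-! ### The quadratic inequality for coefficients -/

/-- The coefficient of `F` at `s`, multiplied by `s!`. -/
noncomputable def factorialCoeff (s : σ →₀ ℕ) (F : MvPolynomial σ ℝ) : ℝ :=
  (∏ i, ((s i).factorial : ℝ)) * coeff s F

/-- The factorial weight absorbs the factor `s k + 1`, so differentiation becomes a pure shift of
exponents. -/
theorem factorialCoeff_pderiv (s : σ →₀ ℕ) (k : σ) (F : MvPolynomial σ ℝ) :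
    factorialCoeff s (pderiv k F) = factorialCoeff (s + Finsupp.single k 1) F := by
  classical
  have h : ∏ i, (((s + Finsupp.single k 1 : σ →₀ ℕ) i).factorial : ℝ) =
      (∏ i, ((s i).factorial : ℝ)) * (s k + 1) := by
    rw [← Finset.mul_prod_erase _ _ (Finset.mem_univ k),
      ← Finset.mul_prod_erase Finset.univ (fun i => ((s i).factorial : ℝ)) (Finset.mem_univ k)]
    rw [Finset.prod_congr rfl (g := fun i => ((s i).factorial : ℝ))]
    · simp [Nat.factorial_succ]; ring
    · intro i hi
      simp [(Finset.ne_of_mem_erase hi).symm]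
  rw [factorialCoeff, factorialCoeff, coeff_pderiv, h]
  ring

/-- The bilinear form of the Hessian at `0`. -/
noncomputable def hessian (F : MvPolynomial σ ℝ) (u v : σ → ℝ) : ℝ :=
  ∑ k, ∑ l, factorialCoeff (Finsupp.single k 1 + Finsupp.single l 1) F * (u k * v l)

theorem hessian_comm (F : MvPolynomial σ ℝ) (u v : σ → ℝ) : hessian F u v = hessian F v u := by
  unfold hessian
  rw [Finset.sum_comm]
  refine Finset.sum_congr rfl fun k _ => Finset.sum_congr rfl fun l _ => ?_
  rw [add_comm (Finsupp.single l 1), mul_comm (u l)]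

/-- Euler's identity, applied to `F` and then to its first derivatives. -/
theorem two_mul_aeval_of_isHomogeneous_two {F : MvPolynomial σ ℝ} (hF : F.IsHomogeneous 2)
    (w : σ → ℂ) : 2 * aeval w F = ∑ k, ∑ l,
      (factorialCoeff (Finsupp.single k 1 + Finsupp.single l 1) F : ℂ) * (w k * w l) := by
  have hconst (k l : σ) : pderiv l (pderiv k F) =
      C (factorialCoeff (Finsupp.single k 1 + Finsupp.single l 1) F) := by
    have h0 : (pderiv l (pderiv k F)).IsHomogeneous 0 := hF.pderiv.pderiv
    have h1 := totalDegree_eq_zero_iff_eq_C.mp (Nat.le_zero.mp h0.totalDegree_le)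
    rw [h1]
    have h2 := factorialCoeff_pderiv 0 l (pderiv k F)
    rw [zero_add, factorialCoeff_pderiv (Finsupp.single l 1), add_comm (Finsupp.single l 1)] at h2
    rw [← h2]
    simp [factorialCoeff]
  have h1 : 2 * aeval w F = ∑ k, w k * aeval w (pderiv k F) := by
    have := congrArg (aeval w) hF.sum_X_mul_pderiv
    simpa using this.symm
  have h2 (k : σ) : aeval w (pderiv k F) =
      ∑ l, w l * (factorialCoeff (Finsupp.single k 1 + Finsupp.single l 1) F : ℂ) := by
    have := congrArg (aeval w) (hF.pderiv (i := k)).sum_X_mul_pderiv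
    simpa [hconst] using this.symm
  rw [h1]
  refine Finset.sum_congr rfl fun k _ => ?_
  rw [h2, Finset.mul_sum]
  exact Finset.sum_congr rfl fun l _ => by ring

/-- On the line `u + t v` the polynomial is a real quadratic in `t` without roots in the upper
half-plane, so its discriminant is nonnegative. -/
theorem IsStable.hessian_mul_le {F : MvPolynomial σ ℝ} (hF : F.IsHomogeneous 2)
    (hs : IsStable F) (u : σ → ℝ) {v : σ → ℝ} (hv : ∀ i, 0 < v i) :
    hessian F u u * hessian F v v ≤ hessian F u v ^ 2 := by
  have hline (t : ℂ) : 2 * aeval (fun i => (u i : ℂ) + t * v i) F =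
      hessian F u u + 2 * hessian F u v * t + hessian F v v * t ^ 2 := by
    have hsymm : (2 : ℂ) * hessian F u v = hessian F u v + hessian F v u := by
      rw [hessian_comm F v u]; ring
    rw [two_mul_aeval_of_isHomogeneous_two hF, hsymm]
    simp only [hessian, Complex.ofReal_sum, add_mul, Finset.sum_mul, ← Finset.sum_add_distrib]
    refine Finset.sum_congr rfl fun k _ => Finset.sum_congr rfl fun l _ => ?_
    push_cast
    ring
  have hvv : hessian F v v ≠ 0 := by
    intro h
    apply hs.aeval_ofReal_ne_zero hF hv
    have := two_mul_aeval_of_isHomogeneous_two hF fun i => (v i : ℂ)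
    have h' : (hessian F v v : ℂ) = 0 := by rw [h]; simp
    simp only [hessian] at h'
    push_cast at h'
    rw [h'] at this
    simpa using this
  have hne (t : ℂ) (ht : 0 < t.im) :
      (hessian F u u : ℂ) + 2 * hessian F u v * t + hessian F v v * t ^ 2 ≠ 0 := by
    rw [← hline]
    refine mul_ne_zero two_ne_zero (hs _ fun i => ?_)
    simpa using mul_pos ht (hv i)
  generalize hessian F u u = c at *
  generalize hessian F u v = b at *
  generalize hessian F v v = a at *
  by_contra! hlt
  set r := Real.sqrt (c * a - b ^ 2)
  have hr : r ^ 2 = c * a - b ^ 2 := Real.sq_sqrt (by linarith)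
  have hr0 : 0 < r := Real.sqrt_pos.mpr (by linarith)
  -- The root of `c + 2 b t + a t²` in the upper half-plane; the absolute value is there because the
  -- sign of `a` is unknown.
  refine hne ⟨-b / a, r / |a|⟩ (by positivity) ?_
  have habs : |a| ^ 2 = a ^ 2 := sq_abs a
  have habs0 : |a| ≠ 0 := abs_ne_zero.mpr hvv
  apply Complex.ext
  · simp [sq]
    field_simp
    rw [habs]
    field_simp
    linarith
  · simp [sq]
    field_simp
    ring

theorem IsStableLimit.hessian_le {F : MvPolynomial σ ℝ} (hF : IsStableLimit 2 F) (i j : σ) :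
    factorialCoeff (Finsupp.single i 1 + Finsupp.single i 1) F *
        factorialCoeff (Finsupp.single j 1 + Finsupp.single j 1) F ≤
      factorialCoeff (Finsupp.single i 1 + Finsupp.single j 1) F ^ 2 := by
  classical
  obtain ⟨G, hG, hlim⟩ := hF
  have hlim' (u v : ℕ → σ → ℝ) (i j : σ)
      (hu : ∀ k, Tendsto (fun m => u m k) atTop (𝓝 ((Pi.single i 1 : σ → ℝ) k)))
      (hv : ∀ k, Tendsto (fun m => v m k) atTop (𝓝 ((Pi.single j 1 : σ → ℝ) k))) :
      Tendsto (fun m => hessian (G m) (u m) (v m)) atTop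
        (𝓝 (factorialCoeff (Finsupp.single i 1 + Finsupp.single j 1) F)) := by
    have h : Tendsto (fun m => hessian (G m) (u m) (v m)) atTop
        (𝓝 (hessian F (Pi.single i 1) (Pi.single j 1))) :=
      tendsto_finsetSum _ fun k _ => tendsto_finsetSum _ fun l _ =>
        ((hlim _).const_mul _).mul ((hu k).mul (hv l))
    simpa [hessian, Pi.single_apply] using h
  have hi := tendsto_perturbedBasis (σ := σ) i
  have hj := tendsto_perturbedBasis (σ := σ) j
  exact le_of_tendsto_of_tendsto' ((hlim' _ _ i i hi hi).mul (hlim' _ _ j j hj hj))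
    ((hlim' _ _ i j hi hj).pow 2) fun m =>
      (hG m).2.hessian_mul_le (hG m).1 _ (perturbedBasis_pos j m)

/-- Differentiating once for each unit of `s` shifts the exponent away and reduces to degree 2. -/
theorem IsStableLimit.factorialCoeff_mul_le {N : ℕ} {F : MvPolynomial σ ℝ}
    (hF : IsStableLimit N F) (s : σ →₀ ℕ) (hs : s.degree + 2 = N) (i j : σ) :
    factorialCoeff (s + (Finsupp.single i 1 + Finsupp.single i 1)) F *
        factorialCoeff (s + (Finsupp.single j 1 + Finsupp.single j 1)) F ≤
      factorialCoeff (s + (Finsupp.single i 1 + Finsupp.single j 1)) F ^ 2 := by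
  classical
  induction N generalizing s F with
  | zero => omega
  | succ N ih =>
    rcases eq_or_ne s 0 with rfl | hne
    · obtain rfl : N = 1 := by simp at hs; omega
      simpa only [zero_add] using hF.hessian_le i j
    · obtain ⟨k, hk⟩ := Finsupp.ne_iff.mp hne
      obtain ⟨s, rfl⟩ : ∃ s', s = s' + Finsupp.single k 1 :=
        ⟨s - Finsupp.single k 1, (tsub_add_cancel_of_le (by
          simpa [Finsupp.single_le_iff] using Nat.one_le_iff_ne_zero.mpr hk)).symm⟩
      have := ih (hF.pderiv k) s (by simp at hs; omega)
      simpa only [factorialCoeff_pderiv, add_right_comm] using this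

end Fischer

/-! ### The stable polynomial attached to a positive semidefinite matrix -/

namespace Fischer

open MvPolynomial Filter Topology Matrix

variable {d : ℕ}

/-- Multilinearity in the rows: `S` is the set of rows taken from `x • A`. -/
theorem det_diagonal_add_smul (A : Matrix (Fin d) (Fin d) ℂ) (z : Fin d → ℂ) (x : ℂ) :
    (diagonal z + x • A).det =
      ∑ S : Finset (Fin d), (∏ a ∈ Sᶜ, z a) * x ^ S.card * (principalSubmatrix A S).det := by
  let D := (detRowAlternating : (Fin d → ℂ) [⋀^Fin d]→ₗ[ℂ] ℂ)
  have h0 : (diagonal z + x • A).det = D ((fun i => (x • A) i) + fun i => diagonal z i) := by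
    rw [add_comm]; rfl
  rw [h0, D.map_add_univ]
  refine Finset.sum_congr rfl fun S _ => ?_
  have h : S.piecewise (fun i => (x • A) i) (fun i => diagonal z i) = fun i =>
      (if i ∈ S then x else z i) •
        (S.piecewise A.row (1 : Matrix (Fin d) (Fin d) ℂ).row : Fin d → Fin d → ℂ) i := by
    funext i j
    by_cases hi : i ∈ S
    · simp [Finset.piecewise, hi]
    · simp [Finset.piecewise, hi, diagonal_apply, one_apply]
  rw [h, D.map_smul_univ, smul_eq_mul]
  congr 1
  · rw [Finset.prod_ite, mul_comm, Finset.prod_const]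
    congr 2
    · ext; simp
    · simp
  · exact det_piecewise_one_eq_submatrix_det A S

/-- For a kernel vector `v`, the imaginary part of `v* (diag z + x A) v` is `∑ Im zₐ |vₐ|² + Im x ·
v* A v`, which is positive. -/
theorem det_ne_zero_of_im_pos {A : Matrix (Fin d) (Fin d) ℂ} (hA : A.PosSemidef)
    {z : Fin d → ℂ} (hz : ∀ a, 0 < (z a).im) {x : ℂ} (hx : 0 < x.im) :
    (diagonal z + x • A).det ≠ 0 := by
  intro h0
  obtain ⟨v, hv, hMv⟩ := exists_mulVec_eq_zero_iff.mpr h0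
  have hq : star v ⬝ᵥ ((diagonal z + x • A) *ᵥ v) = 0 := by rw [hMv, dotProduct_zero]
  have hAv := Complex.nonneg_iff.mp (hA.dotProduct_mulVec_nonneg v)
  rw [add_mulVec, dotProduct_add, smul_mulVec, dotProduct_smul, smul_eq_mul] at hq
  have him := congrArg Complex.im hq
  rw [Complex.add_im, Complex.mul_im, ← hAv.2, mul_zero, zero_add, Complex.zero_im] at him
  have hdiag : (star v ⬝ᵥ (diagonal z *ᵥ v)).im = ∑ a, (z a).im * Complex.normSq (v a) := by
    simp only [dotProduct, mulVec_diagonal, Complex.im_sum]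
    refine Finset.sum_congr rfl fun a _ => ?_
    rw [Complex.normSq_apply]
    simp
    ring
  obtain ⟨a, ha⟩ := Function.ne_iff.mp hv
  have hpos : 0 < ∑ a, (z a).im * Complex.normSq (v a) :=
    Finset.sum_pos' (fun b _ => mul_nonneg (hz b).le (Complex.normSq_nonneg _))
      ⟨a, Finset.mem_univ _, mul_pos (hz a) (Complex.normSq_pos.mpr ha)⟩
  rw [hdiag] at him
  have := mul_nonneg hx.le hAv.1
  linarith

/-- The exponent of the monomial `xᵢ ^ |S| ∏ₐ zₐ`, where `a` runs over the complement of `S`. -/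
noncomputable def minorExponent {n : ℕ} (i : Fin n) (S : Finset (Fin d)) : Fin d ⊕ Fin n →₀ ℕ :=
  Finsupp.equivFunOnFinite.symm
    (Sum.elim (fun a => if a ∈ S then 0 else 1) (Pi.single i S.card))

/-- The product of the polynomials `det (diagonal z + xᵢ A)`, with real coefficients. -/
noncomputable def fischerPolynomial (n : ℕ) (A : Matrix (Fin d) (Fin d) ℂ) :
    MvPolynomial (Fin d ⊕ Fin n) ℝ :=
  ∏ i, ∑ S : Finset (Fin d), monomial (minorExponent i S) (principalSubmatrix A S).det.re

theorem isHomogeneous_fischerPolynomial (n : ℕ) (A : Matrix (Fin d) (Fin d) ℂ) :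
    (fischerPolynomial n A).IsHomogeneous (n * d) := by
  have h := IsHomogeneous.prod (Finset.univ : Finset (Fin n)) (fun i => ∑ S : Finset (Fin d),
    monomial (minorExponent i S) (principalSubmatrix A S).det.re) (fun _ => d) fun i _ =>
      IsHomogeneous.sum _ _ _ fun S _ => isHomogeneous_monomial _ ?_
  · simpa [fischerPolynomial] using h
  · rw [Finsupp.degree_eq_sum, Fintype.sum_sum_type]
    have h1 : ∑ a : Fin d, (if a ∈ S then 0 else 1) = Sᶜ.card := by
      rw [Finset.card_eq_sum_ones, ← Finset.sum_filter_of_ne (p := (· ∈ Sᶜ)) (by simp)]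
      refine Finset.sum_congr (by ext; simp) fun a ha => ?_
      simpa using ha
    have h2 := Finset.card_add_card_compl S
    simp only [Fintype.card_fin] at h2
    simp [minorExponent, h1]

theorem det_principalSubmatrix_nonneg {A : Matrix (Fin d) (Fin d) ℂ} (hA : A.PosSemidef)
    (S : Finset (Fin d)) : 0 ≤ (principalSubmatrix A S).det :=
  (hA.submatrix _).det_nonneg

theorem ofReal_re_det_principalSubmatrix {A : Matrix (Fin d) (Fin d) ℂ} (hA : A.PosSemidef)
    (S : Finset (Fin d)) :
    ((principalSubmatrix A S).det.re : ℂ) = (principalSubmatrix A S).det :=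
  Complex.ext rfl (Complex.nonneg_iff.mp (det_principalSubmatrix_nonneg hA S)).2

theorem isStable_fischerPolynomial (n : ℕ) {A : Matrix (Fin d) (Fin d) ℂ} (hA : A.PosSemidef) :
    IsStable (fischerPolynomial n A) := by
  intro w hw
  rw [fischerPolynomial, map_prod, Finset.prod_ne_zero_iff]
  intro i _
  convert det_ne_zero_of_im_pos hA (z := fun a => w (.inl a)) (fun a => hw _) (hw (.inr i)) using 1
  rw [det_diagonal_add_smul, map_sum]
  refine Finset.sum_congr rfl fun S _ => ?_
  rw [aeval_monomial, Finsupp.prod_fintype _ _ (by simp), Fintype.prod_sum_type,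
    Complex.coe_algebraMap, ofReal_re_det_principalSubmatrix hA, mul_comm]
  congr 2
  · rw [← Finset.prod_subset (Finset.subset_univ Sᶜ)]
    · refine Finset.prod_congr rfl fun a ha => ?_
      simp [minorExponent, Finset.mem_compl.mp ha]
    · intro a _ ha
      simp [minorExponent, not_not.mp (mt Finset.mem_compl.mpr ha)]
  · rw [Finset.prod_eq_single i]
    · simp [minorExponent]
    · intro j _ hj; simp [minorExponent, hj]
    · simp

/-- The exponent of `(∏ₐ zₐ) ^ (n - 1) ∏ᵢ xᵢ ^ αᵢ`. -/
noncomputable def partitionExponent (d : ℕ) {n : ℕ} (α : Fin n → ℕ) : Fin d ⊕ Fin n →₀ ℕ :=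
  Finsupp.equivFunOnFinite.symm (Sum.elim (fun _ => n - 1) α)

/-- The exponent of `zₐ` counts the `i` with `a ∉ S i`; it equals `n - 1` exactly when `a` lies in a
single part. -/
theorem sum_minorExponent_eq_iff {n : ℕ} (α : Fin n → ℕ) (hα : ∑ i, α i = d)
    (S : Fin n → Finset (Fin d)) :
    ∑ i, minorExponent i (S i) = partitionExponent d α ↔ S ∈ orderedPartitions d α := by
  have hsum (x : Fin d ⊕ Fin n) :
      (∑ i, minorExponent i (S i)) x = ∑ i, minorExponent i (S i) x := by
    simp
  have hinr (i : Fin n) : (∑ j, minorExponent j (S j)) (.inr i) = (S i).card := by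
    rw [hsum, Finset.sum_eq_single i]
    · simp [minorExponent]
    · intro j _ hj; simp [minorExponent, hj.symm]
    · simp
  have hinl (a : Fin d) : (∑ j, minorExponent j (S j)) (.inl a) +
      (Finset.univ.filter fun i => a ∈ S i).card = n := by
    rw [hsum, Finset.card_filter, ← Finset.sum_add_distrib, Finset.sum_congr rfl (g := fun _ => 1)]
    · simp
    · intro i _
      by_cases h : a ∈ S i <;> simp [minorExponent, h]
  have hone (a : Fin d) : (∑ j, minorExponent j (S j)) (.inl a) = n - 1 ↔ ∃! i, a ∈ S i := by
    -- Guards the truncated subtraction `n - 1`: if `n = 0` then `d = 0` and there is no `a`.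
    have hn : n ≠ 0 := by
      rintro rfl
      simp at hα
      subst hα
      exact a.elim0
    have h1 : (∃! i, a ∈ S i) ↔ (Finset.univ.filter fun i => a ∈ S i).card = 1 := by
      rw [← Fintype.existsUnique_iff_card_one]
    rw [h1]
    have := hinl a
    omega
  have hcov : ((∀ i j, i ≠ j → Disjoint (S i) (S j)) ∧ Finset.univ.biUnion S = Finset.univ) ↔
      ∀ a, ∃! i, a ∈ S i := by
    constructor
    · rintro ⟨h1, h2⟩ a
      have ha := Finset.mem_univ a
      rw [← h2, Finset.mem_biUnion] at ha
      obtain ⟨i, _, hi⟩ := ha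
      refine ⟨i, hi, fun j hj => ?_⟩
      by_contra hne
      exact Finset.disjoint_left.mp (h1 j i hne) hj hi
    · intro h
      refine ⟨fun i j hij => Finset.disjoint_left.mpr fun a hi hj => hij ((h a).unique hi hj), ?_⟩
      ext a
      simpa using (h a).exists
  rw [orderedPartitions, Finset.mem_filter_univ, ← and_assoc, hcov, Finsupp.ext_iff, Sum.forall]
  simp only [hinr, partitionExponent, Finsupp.equivFunOnFinite_symm_apply_apply, Sum.elim_inl,
    Sum.elim_inr, hone]

theorem coeff_fischerPolynomial {n : ℕ} (α : Fin n → ℕ) (hα : ∑ i, α i = d)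
    (A : Matrix (Fin d) (Fin d) ℂ) : coeff (partitionExponent d α) (fischerPolynomial n A) =
      ∑ S ∈ orderedPartitions d α, ∏ i, (principalSubmatrix A (S i)).det.re := by
  classical
  rw [fischerPolynomial, Finset.prod_univ_sum, coeff_sum]
  have h (S : Fin n → Finset (Fin d)) :
      ∏ i, monomial (minorExponent i (S i)) (principalSubmatrix A (S i)).det.re =
        monomial (∑ i, minorExponent i (S i)) (∏ i, (principalSubmatrix A (S i)).det.re) :=
    (monomial_sum_prod _ _ _).symm
  simp only [h, coeff_monomial, sum_minorExponent_eq_iff α hα]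
  simp

/-! ### Average products as weighted coefficients; log-concavity -/

/-- The exponent's factorials give `(n-1)!^d ∏ αᵢ!`, and `∏ αᵢ!` times the multinomial coefficient
is `d!`. The prefactor does not depend on `α`, so inequalities between coefficients transfer. -/
theorem averageProduct_eq {n : ℕ} (α : Fin n → ℕ) (hα : ∑ i, α i = d)
    {A : Matrix (Fin d) (Fin d) ℂ} (hA : A.PosSemidef) :
    averageProduct α A = ((((n - 1).factorial ^ d * d.factorial : ℕ) : ℝ)⁻¹ *
      factorialCoeff (partitionExponent d α) (fischerPolynomial n A) : ℝ) := by
  have h1 : symmetrizedProduct α A = (coeff (partitionExponent d α) (fischerPolynomial n A) : ℝ) := by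
    rw [coeff_fischerPolynomial α hα, symmetrizedProduct]
    push_cast
    simp only [ofReal_re_det_principalSubmatrix hA]
  have h2 := Nat.multinomial_spec Finset.univ α
  have h3 : (Nat.multinomial Finset.univ α : ℂ) ≠ 0 :=
    Nat.cast_ne_zero.mpr (Nat.multinomial_pos _ _).ne'
  have h4 : ∏ i, ((partitionExponent d α i).factorial : ℝ) =
      ((n - 1).factorial ^ d * ∏ i, (α i).factorial : ℕ) := by
    simp [partitionExponent, Fintype.prod_sum_type]
  rw [hα] at h2
  rw [averageProduct, h1, factorialCoeff, h4, ← h2]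
  have h5 : (∏ i, ((α i).factorial : ℂ)) ≠ 0 :=
    Finset.prod_ne_zero_iff.mpr fun i _ => Nat.cast_ne_zero.mpr (Nat.factorial_ne_zero _)
  have h6 : ((n - 1).factorial : ℂ) ≠ 0 := Nat.cast_ne_zero.mpr (Nat.factorial_ne_zero _)
  push_cast
  field_simp

theorem partitionExponent_add_single {n : ℕ} (γ : Fin n → ℕ) (i : Fin n) :
    partitionExponent d (γ + Pi.single i 1) =
      partitionExponent d γ + Finsupp.single (.inr i) 1 := by
  ext (a | l)
  · simp [partitionExponent]
  · simp [partitionExponent, Finsupp.single_apply, Pi.single_apply, eq_comm]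

theorem averageProduct_mul_le {n : ℕ} (γ : Fin n → ℕ) (i j : Fin n) (hγ : ∑ l, γ l + 2 = d)
    {A : Matrix (Fin d) (Fin d) ℂ} (hA : A.PosSemidef) :
    averageProduct (γ + Pi.single i 1 + Pi.single i 1) A *
        averageProduct (γ + Pi.single j 1 + Pi.single j 1) A ≤
      averageProduct (γ + Pi.single i 1 + Pi.single j 1) A ^ 2 := by
  have hsum (k l : Fin n) : ∑ m, (γ + Pi.single k 1 + Pi.single l 1 : Fin n → ℕ) m = d := by
    simp [Finset.sum_add_distrib, ← hγ]
  rw [averageProduct_eq _ (hsum i i) hA, averageProduct_eq _ (hsum j j) hA,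
    averageProduct_eq _ (hsum i j) hA]
  simp only [partitionExponent_add_single]
  simp only [add_assoc]
  norm_cast
  have hn : n ≠ 0 := fun h => (h ▸ i).elim0
  have hdeg : (partitionExponent d γ).degree + 2 = n * d := by
    rw [Finsupp.degree_eq_sum, Fintype.sum_sum_type]
    obtain ⟨n, rfl⟩ := Nat.exists_eq_succ_of_ne_zero hn
    simp [partitionExponent]
    rw [add_assoc, hγ]
    ring
  have h := ((isStable_fischerPolynomial n hA).isStableLimit
    (isHomogeneous_fischerPolynomial n A)).factorialCoeff_mul_le _ hdeg (.inr i) (.inr j)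
  rw [mul_mul_mul_comm, mul_pow, sq (_⁻¹)]
  exact mul_le_mul_of_nonneg_left h (mul_self_nonneg _)

theorem averageProduct_shift_mul_le {n : ℕ} (α : Fin n → ℕ) (i j : Fin n) (k : ℤ)
    (hα : ∑ l, α l = d) (hj : 0 < α j) (hki : -(α i : ℤ) + 1 ≤ k) (hkj : k ≤ (α j : ℤ) - 1)
    {A : Matrix (Fin d) (Fin d) ℂ} (hA : A.PosSemidef) :
    averageProduct (shift α i j (k - 1)) A * averageProduct (shift α i j (k + 1)) A ≤
      averageProduct (shift α i j k) A ^ 2 := by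
  rcases eq_or_ne i j with rfl | hij
  · have hshift (k : ℤ) : shift α i i k = α := by
      funext l
      simp [shift]
    simp only [hshift, sq, le_refl]
  -- The common part `α + k (eᵢ - eⱼ) - eᵢ - eⱼ` of the three multi-indices; the bounds on `k` are
  -- exactly what keeps it nonnegative.
  let γ : Fin n → ℕ := fun l => if l = i then (α i + k - 1).toNat else
    if l = j then (α j - k - 1).toNat else α l
  have hshift (k : ℤ) (l : Fin n) : shift α i j k l = if l = i then (α i + k).toNat else
      if l = j then (α j - k).toNat else α l := by
    rcases eq_or_ne l i with rfl | hi
    · simp [shift, hij]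
    · rcases eq_or_ne l j with rfl | hj
      · simp [shift, hi, sub_eq_add_neg]
      · simp [shift, hi, hj]
  have h0 : shift α i j k = γ + Pi.single i 1 + Pi.single j 1 := by
    funext l
    rw [hshift]
    simp only [γ, Pi.add_apply, Pi.single_apply]
    split_ifs <;> omega
  have h1 : shift α i j (k + 1) = γ + Pi.single i 1 + Pi.single i 1 := by
    funext l
    rw [hshift]
    simp only [γ, Pi.add_apply, Pi.single_apply]
    split_ifs <;> omega
  have h2 : shift α i j (k - 1) = γ + Pi.single j 1 + Pi.single j 1 := by
    funext l
    rw [hshift]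
    simp only [γ, Pi.add_apply, Pi.single_apply]
    split_ifs <;> omega
  have hsum : ∑ l, γ l + 2 = d := by
    have h3 : ∑ l, ((γ + Pi.single i 1 + Pi.single j 1 : Fin n → ℕ) l : ℤ) = ∑ l, (α l : ℤ) := by
      rw [← sub_eq_zero, ← Finset.sum_sub_distrib]
      rw [Finset.sum_congr rfl (g := fun l => Pi.single i k l - Pi.single j k l)]
      · simp
      · intro l _
        simp only [γ, Pi.add_apply, Pi.single_apply]
        split_ifs <;> subst_vars <;> push_cast <;> omega
    have h4 : ∑ l, (γ + Pi.single i 1 + Pi.single j 1 : Fin n → ℕ) l = ∑ l, α l := by exact_mod_cast h3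
    rw [← hα, ← h4]
    simp [Finset.sum_add_distrib]
  rw [h0, h1, h2, mul_comm]
  exact averageProduct_mul_le γ i j hsum hA

end Fischer

/-! ### Monotonicity under moving one unit -/

namespace Fischer

open Filter Topology Matrix

variable {d n : ℕ}

theorem orderedPartitions_nonempty (α : Fin n → ℕ) (hα : ∑ i, α i = d) :
    (orderedPartitions d α).Nonempty := by
  subst hα
  let e := finSigmaFinEquiv (n := α)
  refine ⟨fun i => Finset.univ.map ((Function.Embedding.sigmaMk i).trans e.toEmbedding), ?_⟩
  rw [orderedPartitions, Finset.mem_filter_univ]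
  refine ⟨fun i j hij => Finset.disjoint_left.mpr ?_, ?_, fun i => by simp⟩
  · intro a hi hj
    simp only [Finset.mem_map, Finset.mem_univ, true_and] at hi hj
    obtain ⟨x, rfl⟩ := hi
    obtain ⟨y, hy⟩ := hj
    exact hij (congrArg Sigma.fst (e.injective hy)).symm
  · ext a
    simp only [Finset.mem_biUnion, Finset.mem_univ, Finset.mem_map, true_and, iff_true]
    exact ⟨(e.symm a).1, (e.symm a).2, e.apply_symm_apply a⟩

theorem averageProduct_pos (α : Fin n → ℕ) (hα : ∑ i, α i = d) {A : Matrix (Fin d) (Fin d) ℂ}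
    (hA : A.PosDef) : 0 < averageProduct α A := by
  refine mul_pos ?_ (Finset.sum_pos (fun S _ => Finset.prod_pos fun i _ => ?_)
    (orderedPartitions_nonempty α hα))
  · exact inv_pos.mpr (Nat.cast_pos.mpr (Nat.multinomial_pos _ _))
  · exact (hA.submatrix Subtype.val_injective).det_pos

theorem averageProduct_comp_perm (α : Fin n → ℕ) (e : Equiv.Perm (Fin n))
    (A : Matrix (Fin d) (Fin d) ℂ) : averageProduct (α ∘ e) A = averageProduct α A := by
  have h1 : Nat.multinomial Finset.univ (α ∘ e) = Nat.multinomial Finset.univ α := by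
    simp only [Nat.multinomial, Function.comp_apply]
    rw [Equiv.sum_comp e α, Equiv.prod_comp e fun i => (α i).factorial]
  have h2 : symmetrizedProduct (α ∘ e) A = symmetrizedProduct α A := by
    refine (Finset.sum_equiv (Equiv.arrowCongr e.symm (Equiv.refl _)) (fun S => ?_)
      fun S _ => ?_).symm
    · simp only [orderedPartitions, Finset.mem_filter_univ, Equiv.arrowCongr_apply, Equiv.symm_symm,
        Equiv.coe_refl, Function.comp_apply]
      refine and_congr ⟨fun h i j hij => h _ _ (e.injective.ne hij), fun h i j hij => ?_⟩
        (and_congr ?_ ⟨fun h i => h _, fun h i => ?_⟩)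
      · simpa using h (e.symm i) (e.symm j) (e.symm.injective.ne hij)
      · have : Finset.univ.biUnion (S ∘ e) = Finset.univ.biUnion S := by
          ext a
          simp only [Finset.mem_biUnion, Finset.mem_univ, true_and, Function.comp_apply]
          exact e.exists_congr_left.trans (by simp)
        change _ ↔ Finset.univ.biUnion (S ∘ e) = Finset.univ
        rw [this]
      · simpa using h (e.symm i)
    · exact (Equiv.prod_comp e fun i => (principalSubmatrix A (S i)).det).symm
  rw [averageProduct, averageProduct, h1, h2]

/-- A positive, symmetric, log-concave finite sequence increases up to its middle. -/
theorem le_succ_of_logConcave (a : ℕ → ℝ) (m : ℕ) (hpos : ∀ k ≤ m, 0 < a k)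
    (hsymm : ∀ k ≤ m, a (m - k) = a k) (hlog : ∀ k, k + 2 ≤ m → a k * a (k + 2) ≤ a (k + 1) ^ 2)
    (k : ℕ) (hk : 2 * k + 2 ≤ m) : a k ≤ a (k + 1) := by
  by_contra! hlt
  -- After one strict descent, log-concavity and positivity force strict descent up to index `m`;
  -- reaching `m - k` contradicts the symmetry.
  have step (t : ℕ) (ht : k + t + 1 ≤ m) : a (k + t + 1) < a (k + t) ∧ a (k + t + 1) < a k := by
    induction t with
    | zero => exact ⟨hlt, hlt⟩
    | succ t ih =>
      have h1 := ih (by omega)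
      have h2 := hlog (k + t) (by omega)
      have h3 := hpos (k + t) (by omega)
      have h4 := hpos (k + t + 1) (by omega)
      have h5 : a (k + t + 2) < a (k + t + 1) := by
        by_contra! h
        nlinarith [mul_lt_mul_of_pos_right h1.1 h4, mul_le_mul_of_nonneg_left h h3.le]
      exact ⟨h5, h5.trans h1.2⟩
  have h := (step (m - k - k - 1) (by omega)).2
  rw [show k + (m - k - k - 1) + 1 = m - k by omega, hsymm k (by omega)] at h
  exact lt_irrefl _ h

/-- The tuple `α` with one unit moved from position `i` to position `j`. -/
def moveUnit (α : Fin n → ℕ) (i j : Fin n) : Fin n → ℕ :=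
  Function.update (Function.update α i (α i - 1)) j (α j + 1)

theorem averageProduct_re_le_moveUnit (α : Fin n → ℕ) (hα : ∑ i, α i = d) (i j : Fin n)
    (hij : α j + 2 ≤ α i) {A : Matrix (Fin d) (Fin d) ℂ} (hA : A.PosDef) :
    (averageProduct α A).re ≤ (averageProduct (moveUnit α i j) A).re := by
  have hne : i ≠ j := by rintro rfl; omega
  set m := α i + α j with hm
  -- The sequence with `k` at `j` and `m - k` at `i`: `α` is its term at `α j` and the moved tuple
  -- is the next one. Exchanging `i` and `j` makes it symmetric, and `hij` says that `α j` lies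
  -- before the middle.
  let b : ℕ → Fin n → ℕ := fun k => Function.update (Function.update α i (m - k)) j k
  have hb (k : ℕ) (l : Fin n) : b k l = if l = j then k else if l = i then m - k else α l := by
    simp [b, Function.update_apply]
  have hsum (k : ℕ) (hk : k ≤ m) : ∑ l, b k l = d := by
    have h : ∑ l, (b k l : ℤ) = ∑ l, (α l : ℤ) := by
      rw [← sub_eq_zero, ← Finset.sum_sub_distrib,
        Finset.sum_congr rfl (g := fun l => Pi.single j ((k : ℤ) - α j) l
          - Pi.single i ((k : ℤ) - α j) l)]
      · simp
      · intro l _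
        rw [hb]
        simp only [Pi.single_apply]
        split_ifs <;> subst_vars <;> omega
    rw [← hα]
    exact_mod_cast h
  have hreal (k : ℕ) (hk : k ≤ m) := Complex.pos_iff.mp (averageProduct_pos (b k) (hsum k hk) hA)
  have key := le_succ_of_logConcave (fun k => (averageProduct (b k) A).re) m
    (fun k hk => (hreal k hk).1) (fun k hk => ?_) (fun k hk => ?_) (α j) (by omega)
  · convert key using 4
    · funext l
      rw [hb]
      split_ifs <;> subst_vars <;> omega
    · funext l
      rw [hb]
      simp only [moveUnit, Function.update_apply]
      split_ifs <;> omega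
  · rw [← averageProduct_comp_perm (b k) (Equiv.swap i j)]
    congr 2
    funext l
    rw [Function.comp_apply, hb, hb]
    rcases eq_or_ne l i with rfl | hi
    · simp [hne, Nat.sub_sub_self hk]
    · rcases eq_or_ne l j with rfl | hj
      · simp [hne]
      · simp [Equiv.swap_apply_of_ne_of_ne hi hj, hi, hj]
  · let γ : Fin n → ℕ := Function.update (Function.update α i (m - k - 2)) j k
    have hγ (l : Fin n) : γ l = if l = j then k else if l = i then m - k - 2 else α l := by
      simp [γ, Function.update_apply]
    have h0 : b k = γ + Pi.single i 1 + Pi.single i 1 := by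
      funext l
      rw [hb]
      simp only [hγ, Pi.add_apply, Pi.single_apply]
      split_ifs <;> omega
    have h1 : b (k + 1) = γ + Pi.single i 1 + Pi.single j 1 := by
      funext l
      rw [hb]
      simp only [hγ, Pi.add_apply, Pi.single_apply]
      split_ifs <;> omega
    have h2 : b (k + 2) = γ + Pi.single j 1 + Pi.single j 1 := by
      funext l
      rw [hb]
      simp only [hγ, Pi.add_apply, Pi.single_apply]
      split_ifs <;> omega
    have hγd : ∑ l, γ l + 2 = d := by
      rw [← hsum k (by omega), h0]
      simp [Finset.sum_add_distrib]
    have h := averageProduct_mul_le γ i j hγd hA.posSemidef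
    rw [← h0, ← h1, ← h2] at h
    have h' := (Complex.le_def.mp h).1
    rw [Complex.mul_re, sq, Complex.mul_re, ← (hreal k (by omega)).2,
      ← (hreal (k + 1) (by omega)).2] at h'
    simpa [sq] using h'

/-! ### Majorization as a chain of unit moves -/

/-- The sum of the first `k` entries of a tuple. -/
def partialSum {M : Type*} [AddCommMonoid M] (x : Fin n → M) (k : ℕ) : M :=
  ∑ l ∈ Finset.univ.filter (fun l : Fin n => (l : ℕ) < k), x l

theorem partialSum_of_le {M : Type*} [AddCommMonoid M] (x : Fin n → M) {k : ℕ} (hk : n ≤ k) :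
    partialSum x k = ∑ l, x l := by
  rw [partialSum, Finset.filter_true_of_mem fun l _ => l.2.trans_le hk]

theorem partialSum_moveUnit (α : Fin n → ℕ) {i j : Fin n} (hij : i ≠ j) (hi : 0 < α i) (k : ℕ) :
    partialSum (moveUnit α i j) k + (if (i : ℕ) < k then 1 else 0) =
      partialSum α k + if (j : ℕ) < k then 1 else 0 := by
  have h (l : Fin n) : moveUnit α i j l + (Pi.single i 1 : Fin n → ℕ) l =
      α l + (Pi.single j 1 : Fin n → ℕ) l := by
    simp only [moveUnit, Function.update_apply, Pi.single_apply]
    split_ifs <;> subst_vars <;> omega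
  have h1 := Finset.sum_congr (rfl : Finset.univ.filter (fun l : Fin n => (l : ℕ) < k) = _)
    fun l _ => h l
  simpa [partialSum, Finset.sum_add_distrib, Finset.sum_pi_single] using h1

theorem partialSum_lt_of_lt_of_eq {α β : Fin n → ℕ} {i : Fin n} {k : ℕ}
    (h : partialSum β i ≤ partialSum α i) (hik : (i : ℕ) < k) (hi : β i < α i)
    (heq : ∀ l : Fin n, i < l → (l : ℕ) < k → β l = α l) : partialSum β k < partialSum α k := by
  have hsplit (x : Fin n → ℕ) : partialSum x k = partialSum x i +
      ∑ l ∈ Finset.univ.filter (fun l : Fin n => i ≤ l ∧ (l : ℕ) < k), x l := by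
    rw [partialSum, partialSum, ← Finset.sum_union]
    · refine Finset.sum_congr ?_ fun _ _ => rfl
      ext l
      simp only [Finset.mem_filter_univ, Finset.mem_union, Fin.le_def]
      omega
    · rw [Finset.disjoint_left]
      intro l
      simp only [Finset.mem_filter_univ, Fin.le_def]
      omega
  rw [hsplit, hsplit]
  refine add_lt_add_of_le_of_lt h (Finset.sum_lt_sum (fun l hl => ?_) ⟨i, by simpa using hik, hi⟩)
  rw [Finset.mem_filter_univ] at hl
  rcases hl.1.eq_or_lt with rfl | hlt
  · exact hi.le
  · exact (heq l hlt hl.2).le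

/-- A function on tuples that does not decrease when a unit is moved from an entry to another one
that is smaller by at least `2` is antitone for the majorization order. -/
theorem le_of_partialSum_le (h : (Fin n → ℕ) → ℝ)
    (hmove : ∀ (α : Fin n → ℕ) (i j : Fin n), ∑ l, α l = d → α j + 2 ≤ α i →
      h α ≤ h (moveUnit α i j))
    (α β : Fin n → ℕ) (hα : ∑ l, α l = d) (hβ : ∑ l, β l = d) (hanti : Antitone β)
    (hle : ∀ k, partialSum β k ≤ partialSum α k) : h α ≤ h β := by
  -- Truncated subtraction makes this the total excess of `α` over `β`, which each move lowers. Only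
  -- `β` must be sorted, so the moved tuple need not be sorted again.
  induction hM : ∑ l, (α l - β l) using Nat.strong_induction_on generalizing α with
  | _ M ih =>
  by_cases hall : ∀ l, β l ≤ α l
  · have : β = α := by
      funext l
      exact (Finset.sum_eq_sum_iff_of_le fun l _ => hall l).mp (hβ.trans hα.symm) l
        (Finset.mem_univ l)
    rw [this]
  push Not at hall
  -- `j` is the first deficient index and `i` below the last index before `j` with an excess, so `α`
  -- and `β` agree between them. Sortedness of `β` gives `α i ≥ β i + 1 ≥ β j + 1 ≥ α j + 2`, so the
  -- move is allowed.
  obtain ⟨j, hj, hjmin⟩ : ∃ j, α j < β j ∧ ∀ l < j, β l ≤ α l := by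
    let s := Finset.univ.filter fun l => α l < β l
    have hs : s.Nonempty := by
      obtain ⟨l, hl⟩ := hall
      exact ⟨l, by simpa [s] using hl⟩
    refine ⟨s.min' hs, by simpa [s] using s.min'_mem hs, fun l hl => ?_⟩
    by_contra! hlt
    exact hl.not_ge (s.min'_le l (by simpa [s] using hlt))
  obtain ⟨i, hij, hi, hmid⟩ : ∃ i < j, β i < α i ∧ ∀ l, i < l → l < j → β l = α l := by
    let s := Finset.univ.filter fun l => l < j ∧ β l < α l
    have hs : s.Nonempty := by
      by_contra hs
      rw [Finset.not_nonempty_iff_eq_empty, Finset.filter_eq_empty_iff] at hs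
      refine (hle (j + 1)).not_gt (Finset.sum_lt_sum (fun l hl => ?_) ⟨j, by simp, hj⟩)
      rw [Finset.mem_filter_univ] at hl
      rcases (Fin.le_def.mpr (Nat.lt_succ_iff.mp hl)).eq_or_lt with rfl | hlt
      · exact hj.le
      · exact not_lt.mp fun h => hs (Finset.mem_univ l) ⟨hlt, h⟩
    have hmem : s.max' hs < j ∧ β (s.max' hs) < α (s.max' hs) := by
      simpa [s] using s.max'_mem hs
    refine ⟨s.max' hs, hmem.1, hmem.2, fun l hl hlj => (hjmin l hlj).antisymm ?_⟩
    by_contra! hlt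
    exact hl.not_ge (s.le_max' l (by simpa [s] using ⟨hlj, hlt⟩))
  have hβij := hanti hij.le
  have hps := partialSum_moveUnit α hij.ne (by omega)
  have hval (l : Fin n) : moveUnit α i j l =
      if l = j then α j + 1 else if l = i then α i - 1 else α l := by
    simp [moveUnit, Function.update_apply]
  refine (hmove α i j hα (by omega)).trans (ih _ ?_ (moveUnit α i j) ?_ (fun k => ?_) rfl)
  · rw [← hM]
    refine Finset.sum_lt_sum (fun l _ => ?_) ⟨i, Finset.mem_univ i, ?_⟩
    · rw [hval]
      split_ifs <;> subst_vars <;> omega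
    · rw [hval, if_neg hij.ne, if_pos rfl]
      omega
  · have := hps n
    rw [partialSum_of_le _ le_rfl, partialSum_of_le _ le_rfl] at this
    simpa [hα] using this
  · have h1 := hps k
    have h2 := hle k
    rw [Fin.lt_def] at hij
    -- Moving the unit lowers the partial sum only for `i < k ≤ j`; there the original inequality is
    -- strict.
    by_cases hjk : (j : ℕ) < k
    · simp only [hjk, hij.trans hjk, if_true] at h1
      omega
    · by_cases hik : (i : ℕ) < k
      · have h3 := partialSum_lt_of_lt_of_eq (hle i) hik hi fun l hl hlk =>
          hmid l hl (Fin.lt_def.mpr (by omega))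
        simp only [hjk, hik, if_true, if_false] at h1
        omega
      · simp only [hjk, hik, if_false] at h1
        omega

/-! ### The majorization inequality for definite, then semidefinite matrices -/

/-- The permutation that sorts a tuple into decreasing order. -/
noncomputable def decreasingSort (w : Fin n → ℝ) : Equiv.Perm (Fin n) :=
  Fin.revPerm.trans (Tuple.sort w)

theorem averageProduct_re_le_of_posDef {α β : Fin n → ℕ} (hα : ∑ i, α i = d) (hβ : ∑ i, β i = d)
    (hmaj : Majorized (fun i => (β i : ℝ)) (fun i => (α i : ℝ)))
    {A : Matrix (Fin d) (Fin d) ℂ} (hA : A.PosDef) :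
    (averageProduct α A).re ≤ (averageProduct β A).re := by
  set eα := decreasingSort fun i => (α i : ℝ)
  set eβ := decreasingSort fun i => (β i : ℝ)
  rw [← averageProduct_comp_perm α eα, ← averageProduct_comp_perm β eβ]
  have hα' : ∑ i, (α ∘ eα) i = d := by rw [← hα]; exact Equiv.sum_comp eα α
  have hβ' : ∑ i, (β ∘ eβ) i = d := by rw [← hβ]; exact Equiv.sum_comp eβ β
  refine le_of_partialSum_le (d := d) (fun α => (averageProduct α A).re)
    (fun α i j hα hij => averageProduct_re_le_moveUnit α hα i j hij hA) _ _ hα' hβ' ?_ fun k => ?_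
  · intro i j hij
    have := Tuple.monotone_sort (fun i => (β i : ℝ)) (Fin.rev_le_rev.mpr hij)
    exact Nat.cast_le.mp this
  · rcases Nat.eq_zero_or_pos k with rfl | hk
    · simp [partialSum]
    · rcases le_or_gt k n with hkn | hkn
      · have h : ((partialSum (β ∘ eβ) k : ℕ) : ℝ) ≤ (partialSum (α ∘ eα) k : ℕ) := by
          rw [partialSum, partialSum, Nat.cast_sum, Nat.cast_sum]
          exact hmaj.1 k hk hkn
        exact_mod_cast h
      · rw [partialSum_of_le _ hkn.le, partialSum_of_le _ hkn.le, hα', hβ']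

theorem continuous_averageProduct (α : Fin n → ℕ) :
    Continuous fun A : Matrix (Fin d) (Fin d) ℂ => averageProduct α A := by
  unfold averageProduct symmetrizedProduct principalSubmatrix
  exact continuous_const.mul (continuous_finsetSum _ fun S _ => continuous_finsetProd _ fun i _ =>
    (continuous_id.matrix_submatrix _ _).matrix_det)

theorem averageProduct_re_le {α β : Fin n → ℕ} (hα : ∑ i, α i = d) (hβ : ∑ i, β i = d)
    (hmaj : Majorized (fun i => (β i : ℝ)) (fun i => (α i : ℝ)))
    {A : Matrix (Fin d) (Fin d) ℂ} (hA : A.PosSemidef) :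
    (averageProduct α A).re ≤ (averageProduct β A).re := by
  have hlim (α : Fin n → ℕ) : Tendsto (fun ε : ℝ => (averageProduct α
      (A + ε • (1 : Matrix (Fin d) (Fin d) ℂ))).re) (𝓝[>] 0) (𝓝 (averageProduct α A).re) := by
    have hc : Continuous fun ε : ℝ => (averageProduct α
        (A + ε • (1 : Matrix (Fin d) (Fin d) ℂ))).re :=
      Complex.continuous_re.comp ((continuous_averageProduct α).comp (by fun_prop))
    simpa using (hc.tendsto 0).mono_left nhdsWithin_le_nhds
  refine le_of_tendsto_of_tendsto (hlim α) (hlim β) ?_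
  filter_upwards [self_mem_nhdsWithin] with ε hε
  exact averageProduct_re_le_of_posDef hα hβ hmaj
    (PosDef.posSemidef_add hA (PosDef.one.smul hε))

theorem averageProduct_im (α : Fin n → ℕ) (hα : ∑ i, α i = d) {A : Matrix (Fin d) (Fin d) ℂ}
    (hA : A.PosSemidef) : (averageProduct α A).im = 0 := by
  rw [averageProduct_eq α hα hA, Complex.ofReal_im]

end Fischer

theorem mainTheorem5 {d n : ℕ} (A : Matrix (Fin d) (Fin d) ℂ) (hA : A.PosSemidef) :
    (∀ α : Fin n → ℕ, ∑ i, α i = d → (Fischer.averageProduct α A).im = 0) ∧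
    (∀ α β : Fin n → ℕ, ∑ i, α i = d → ∑ i, β i = d →
      Fischer.Majorized (fun i => (β i : ℝ)) (fun i => (α i : ℝ)) →
      Fischer.averageProduct α A ≤ Fischer.averageProduct β A) ∧
    (∀ (α : Fin n → ℕ) (i j : Fin n) (k : ℤ), ∑ l, α l = d → α j ≤ α i → 0 < α j →
      -(α i : ℤ) + 1 ≤ k → k ≤ (α j : ℤ) - 1 →
      Fischer.averageProduct (Fischer.shift α i j (k - 1)) A *
          Fischer.averageProduct (Fischer.shift α i j (k + 1)) A ≤
        Fischer.averageProduct (Fischer.shift α i j k) A ^ 2) := by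
  refine ⟨fun α hα => Fischer.averageProduct_im α hα hA, fun α β hα hβ hmaj => ?_,
    fun α i j k hα _ hj hki hkj => Fischer.averageProduct_shift_mul_le α i j k hα hj hki hkj hA⟩
  rw [Complex.le_def, Fischer.averageProduct_im α hα hA, Fischer.averageProduct_im β hβ hA]
  exact ⟨Fischer.averageProduct_re_le hα hβ hmaj hA, rfl⟩
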